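/- Let $n\ge 3$. An $n$-segment is a point $(z_1,\dots,z_n)\in\mathbb{C}^n$ whose entries $z_1,\dots,z_n$ lie on a common real line in $\mathbb{C}$ and are not all equal. Let $\mathbb{M}(n)\subset\mathbb{C}^n$ be the set of $n$-segments with $z_1=0$. Then $\mathbb{M}(n)$ is a smooth embedded real submanifold of $\mathbb{C}^n$ of dimension $n$. Moreover, let $$T=\Big(\big(\mathbb{R}^{n-1}\smallsetminus\{0\}\big)\times[0,\pi]\Big)\Big/\big((X,0)\sim(-X,\pi)\big)$$ be the mapping torus of $X\mapsto -X$, with its standard smooth structure, given by the two charts $[X,\theta]\mapsto(X,\theta)$ on $\{0<\theta<\pi\}$ and, on $\{\theta\ne\pi/2\}$, $[X,\theta]\mapsto(X,\theta)$ if $\theta<\pi/2$ and $[X,\theta]\mapsto(-X,\theta-\pi)$ if $\theta>\pi/2$. Then the map $$T\to\mathbb{M}(n),\qquad [(x_1,\dots,x_{n-1}),\theta]\mapsto\big(0,e^{i\theta}x_1,\dots,e^{i\theta}x_{n-1}\big),$$ is well defined and is a smooth diffeomorphism. -/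

import Mathlib

open scoped Manifold ContDiff

noncomputable section

/-! Polygons with `n` labelled vertices are points of `ℂⁿ`, written `Fin n → ℂ`; only its topology
and its smooth structure as a real vector space are used. -/

/-- `𝕃(n)`: the set of `n`-segments, i.e. of the nonconstant `n`-tuples of points of the plane
that lie on a common real line. -/
def nSegments (n : ℕ) : Set (Fin n → ℂ) :=
  {Z | Collinear ℝ (Set.range Z) ∧ ∃ i j, Z i ≠ Z j}

/-- `𝕄(n)`: the set of `n`-segments whose first vertex is `0`. -/
def pointedSegments (n : ℕ) : Set (Fin n → ℂ) :=
  {Z | Z ∈ nSegments n ∧ ∀ j : Fin n, (j : ℕ) = 0 → Z j = 0}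

/-- `ℝᵏ ∖ {0}`. -/
abbrev PuncturedSpace (k : ℕ) : Type := {X : Fin k → ℝ // X ≠ 0}

/-- The relation `(X, 0) ∼ (-X, π)` on `(ℝᵏ ∖ {0}) × [0, π]`. -/
def TorusRel (k : ℕ) (p q : PuncturedSpace k × Set.Icc (0 : ℝ) Real.pi) : Prop :=
  (p.2 : ℝ) = 0 ∧ (q.2 : ℝ) = Real.pi ∧ q.1.1 = -p.1.1

/-- The mapping torus `((ℝᵏ ∖ {0}) × [0, π]) / ((X, 0) ∼ (-X, π))`: the quotient by the equivalence
relation generated by `TorusRel k`. -/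
def PuncturedTorus (k : ℕ) : Type := Quot (TorusRel k)

namespace PuncturedTorus

variable {k : ℕ}

/-- The quotient topology. -/
instance : TopologicalSpace (PuncturedTorus k) :=
  inferInstanceAs (TopologicalSpace (Quot (TorusRel k)))

/-- The class of `(X, θ)`. -/
def mk (p : PuncturedSpace k × Set.Icc (0 : ℝ) Real.pi) : PuncturedTorus k := Quot.mk _ p

theorem continuous_mk : Continuous (mk : _ → PuncturedTorus k) := continuous_quot_mk

theorem mk_eq {X Y : PuncturedSpace k} {s t : Set.Icc (0 : ℝ) Real.pi} (hs : (s : ℝ) = 0)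
    (ht : (t : ℝ) = Real.pi) (h : Y.1 = -X.1) : mk (X, s) = mk (Y, t) :=
  Quot.sound ⟨hs, ht, h⟩

/-- `[X, θ]` with `X` and `θ` arbitrary: `θ` is clamped to `[0, π]`, and the value is the
irrelevant `p` if `X = 0`. -/
def point (p : PuncturedTorus k) (X : Fin k → ℝ) (θ : ℝ) : PuncturedTorus k :=
  open Classical in
  if h : X ≠ 0 then mk (⟨X, h⟩, Set.projIcc 0 Real.pi Real.pi_pos.le θ) else p

theorem point_eq (p : PuncturedTorus k) (x : PuncturedSpace k × Set.Icc (0 : ℝ) Real.pi) :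
    point p x.1.1 x.2.1 = mk x := by
  simp [point, x.1.2]

theorem continuousOn_point (p : PuncturedTorus k) :
    ContinuousOn (fun x : (Fin k → ℝ) × ℝ => point p x.1 x.2) {x | x.1 ≠ 0} := by
  rw [continuousOn_iff_continuous_domRestrict]
  have : Set.domRestrict {x : (Fin k → ℝ) × ℝ | x.1 ≠ 0} (fun x => point p x.1 x.2) =
      fun x => mk (⟨x.1.1, x.2⟩, Set.projIcc 0 Real.pi Real.pi_pos.le x.1.2) := by
    funext x
    have hx : x.1.1 ≠ 0 := x.2
    simp [Set.domRestrict, point, hx]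
  rw [this]
  refine continuous_mk.comp (Continuous.prodMk ?_ ?_)
  · fun_prop
  · exact continuous_projIcc.comp (by fun_prop)

/-- The coordinates of `[X, θ]` in the chart over `0 < θ < π`: the pair `(X, θ)`. -/
def coordA : PuncturedTorus k → (Fin k → ℝ) × ℝ :=
  Quot.lift (fun p => if 0 < (p.2 : ℝ) ∧ (p.2 : ℝ) < Real.pi then (p.1.1, (p.2 : ℝ)) else 0) (by
    rintro p q ⟨h1, h2, -⟩
    simp [h1, h2])

/-- The coordinates of `[X, θ]` in the chart over `θ ≠ π / 2`: the pair `(X, θ)` if `θ < π / 2`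
and the pair `(-X, θ - π)` if `θ > π / 2`. -/
def coordB : PuncturedTorus k → (Fin k → ℝ) × ℝ :=
  Quot.lift (fun p => if (p.2 : ℝ) < Real.pi / 2 then (p.1.1, (p.2 : ℝ))
    else (-p.1.1, (p.2 : ℝ) - Real.pi)) (by
    rintro p q ⟨h1, h2, h3⟩
    have := Real.pi_pos
    simp [h1, h2, h3, this, not_lt.2 (half_lt_self this).le])

/-- The inverse of `coordB`: it sends `(X, t)` to `[X, t]` if `0 ≤ t` and to `[-X, t + π]` if
`t < 0`. -/
def pointB (p : PuncturedTorus k) (X : Fin k → ℝ) (t : ℝ) : PuncturedTorus k :=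
  if 0 ≤ t then point p X t else point p (-X) (t + Real.pi)

theorem coordA_mk (x : PuncturedSpace k × Set.Icc (0 : ℝ) Real.pi) :
    coordA (mk x) = if 0 < (x.2 : ℝ) ∧ (x.2 : ℝ) < Real.pi then (x.1.1, (x.2 : ℝ)) else 0 := rfl

theorem coordB_mk (x : PuncturedSpace k × Set.Icc (0 : ℝ) Real.pi) :
    coordB (mk x) = if (x.2 : ℝ) < Real.pi / 2 then (x.1.1, (x.2 : ℝ))
      else (-x.1.1, (x.2 : ℝ) - Real.pi) := rfl

/-- `(ℝᵏ ∖ {0}) × (a, b)`. -/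
def slab (k : ℕ) (a b : ℝ) : Set ((Fin k → ℝ) × ℝ) := {x | x.1 ≠ 0 ∧ a < x.2 ∧ x.2 < b}

theorem isOpen_slab (a b : ℝ) : IsOpen (slab k a b) :=
  (isOpen_ne_fun continuous_fst continuous_const).inter
    ((isOpen_lt continuous_const continuous_snd).inter (isOpen_lt continuous_snd continuous_const))

theorem coordA_mem_iff (x : PuncturedSpace k × Set.Icc (0 : ℝ) Real.pi) :
    coordA (mk x) ∈ slab k 0 Real.pi ↔ 0 < (x.2 : ℝ) ∧ (x.2 : ℝ) < Real.pi := by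
  rw [coordA_mk]
  split_ifs with h
  · simp [slab, h, x.1.2]
  · simp [slab, h]

theorem coordB_mem_iff (x : PuncturedSpace k × Set.Icc (0 : ℝ) Real.pi) :
    coordB (mk x) ∈ slab k (-(Real.pi / 2)) (Real.pi / 2) ↔ (x.2 : ℝ) ≠ Real.pi / 2 := by
  have h0 := x.2.2.1
  have h1 := x.2.2.2
  have := Real.pi_pos
  rw [coordB_mk]
  split_ifs with h
  · simp only [slab, Set.mem_ofPred_eq]
    exact ⟨fun _ => h.ne, fun _ => ⟨x.1.2, by linarith, h⟩⟩
  · simp only [slab, Set.mem_ofPred_eq]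
    refine ⟨fun h' h'' => ?_, fun h' => ⟨neg_ne_zero.2 x.1.2, ?_, ?_⟩⟩
    · linarith [h'.2.1]
    · linarith [lt_of_le_of_ne (not_lt.1 h) (Ne.symm h')]
    · linarith

theorem isOpen_iff (U : Set (PuncturedTorus k)) : IsOpen U ↔ IsOpen (mk ⁻¹' U) :=
  isQuotientMap_quot_mk.isOpen_preimage.symm

theorem continuousOn_of_mk {α : Type*} [TopologicalSpace α] {U : Set (PuncturedTorus k)}
    (hU : IsOpen U) {f : PuncturedTorus k → α} (h : ContinuousOn (f ∘ mk) (mk ⁻¹' U)) :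
    ContinuousOn f U := by
  rw [continuousOn_open_iff hU]
  intro t ht
  rw [isOpen_iff]
  exact (continuousOn_open_iff (continuous_mk.isOpen_preimage _ hU)).1 h t ht

theorem isOpen_sourceA : IsOpen ((coordA : PuncturedTorus k → _) ⁻¹' slab k 0 Real.pi) := by
  have : (mk : _ → PuncturedTorus k) ⁻¹' (coordA ⁻¹' slab k 0 Real.pi) =
      {x | 0 < (x.2 : ℝ)} ∩ {x | (x.2 : ℝ) < Real.pi} := Set.ext coordA_mem_iff
  rw [isOpen_iff, this]
  exact (isOpen_lt (by fun_prop) (by fun_prop)).inter (isOpen_lt (by fun_prop) (by fun_prop))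

theorem coordA_point (p : PuncturedTorus k) {x : (Fin k → ℝ) × ℝ} (hx : x ∈ slab k 0 Real.pi) :
    coordA (point p x.1 x.2) = x := by
  obtain ⟨X, t⟩ := x
  obtain ⟨hX, ht⟩ := hx
  have := point_eq p (⟨X, hX⟩, ⟨t, ht.1.le, ht.2.le⟩)
  dsimp only at this ⊢
  rw [this]
  exact if_pos ht

/-- The chart `[X, θ] ↦ (X, θ)`, from the classes with `0 < θ < π` onto `(ℝᵏ ∖ {0}) × (0, π)`.
The point `p` only serves as a value of the inverse outside its domain. -/
def chartA (p : PuncturedTorus k) :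
    OpenPartialHomeomorph (PuncturedTorus k) ((Fin k → ℝ) × ℝ) where
  toFun := coordA
  invFun x := point p x.1 x.2
  source := coordA ⁻¹' slab k 0 Real.pi
  target := slab k 0 Real.pi
  map_source' _ h := h
  map_target' x hx := by
    rw [Set.mem_preimage, coordA_point p hx]
    exact hx
  left_inv' := by
    rintro ⟨x⟩ hx
    change coordA (mk x) ∈ slab k 0 Real.pi at hx
    change point p (coordA (mk x)).1 (coordA (mk x)).2 = mk x
    rw [coordA_mk, if_pos ((coordA_mem_iff x).1 hx)]
    exact point_eq p x
  right_inv' x hx := coordA_point p hx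
  open_source := isOpen_sourceA
  open_target := isOpen_slab _ _
  continuousOn_toFun := by
    refine continuousOn_of_mk isOpen_sourceA ?_
    refine ContinuousOn.congr (f := fun x => (x.1.1, (x.2 : ℝ))) (by fun_prop) fun x hx => ?_
    exact if_pos ((coordA_mem_iff x).1 hx)
  continuousOn_invFun := (continuousOn_point p).mono fun x hx => hx.1

theorem isOpen_sourceB :
    IsOpen ((coordB : PuncturedTorus k → _) ⁻¹' slab k (-(Real.pi / 2)) (Real.pi / 2)) := by
  have : (mk : _ → PuncturedTorus k) ⁻¹' (coordB ⁻¹' slab k (-(Real.pi / 2)) (Real.pi / 2)) =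
      {x | (x.2 : ℝ) ≠ Real.pi / 2} := Set.ext coordB_mem_iff
  rw [isOpen_iff, this]
  exact isOpen_ne_fun (by fun_prop) (by fun_prop)

theorem coordB_pointB (p : PuncturedTorus k) {x : (Fin k → ℝ) × ℝ}
    (hx : x ∈ slab k (-(Real.pi / 2)) (Real.pi / 2)) : coordB (pointB p x.1 x.2) = x := by
  obtain ⟨X, t⟩ := x
  obtain ⟨hX, h1, h2⟩ := hx
  dsimp only at hX h1 h2 ⊢
  have := Real.pi_pos
  unfold pointB
  split_ifs with ht
  · have h := point_eq p (⟨X, hX⟩, ⟨t, ht, by linarith⟩)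
    dsimp only at h
    rw [h, coordB_mk, if_pos h2]
  · have h := point_eq p (⟨-X, neg_ne_zero.2 hX⟩, ⟨t + Real.pi, by linarith, by linarith⟩)
    dsimp only at h
    rw [h, coordB_mk, if_neg (by dsimp only; linarith)]
    simp

/-- The chart given by `[X, θ] ↦ (X, θ)` for `θ < π / 2` and by `[X, θ] ↦ (-X, θ - π)` for
`θ > π / 2`, from the classes with `θ ≠ π / 2` onto `(ℝᵏ ∖ {0}) × (-π / 2, π / 2)`.
The point `p` only serves as a value of the inverse outside its domain. -/
def chartB (p : PuncturedTorus k) :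
    OpenPartialHomeomorph (PuncturedTorus k) ((Fin k → ℝ) × ℝ) where
  toFun := coordB
  invFun x := pointB p x.1 x.2
  source := coordB ⁻¹' slab k (-(Real.pi / 2)) (Real.pi / 2)
  target := slab k (-(Real.pi / 2)) (Real.pi / 2)
  map_source' _ h := h
  map_target' x hx := by
    rw [Set.mem_preimage, coordB_pointB p hx]
    exact hx
  left_inv' := by
    rintro ⟨x⟩ hx
    change coordB (mk x) ∈ slab k (-(Real.pi / 2)) (Real.pi / 2) at hx
    change pointB p (coordB (mk x)).1 (coordB (mk x)).2 = mk x
    have hx := (coordB_mem_iff x).1 hx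
    have hp := point_eq p x
    have h0 := x.2.2.1
    have h1 := x.2.2.2
    rw [coordB_mk]
    split_ifs with h
    · rw [pointB, if_pos h0, hp]
    · unfold pointB
      dsimp only
      split_ifs with h'
      · have ht : (x.2 : ℝ) = Real.pi := by linarith
        have hq := point_eq p (⟨-x.1.1, neg_ne_zero.2 x.1.2⟩, ⟨0, le_rfl, Real.pi_pos.le⟩)
        dsimp only at hq
        rw [ht, sub_self, hq]
        exact mk_eq rfl ht (by simp)
      · rw [neg_neg, sub_add_cancel, hp]
  right_inv' x hx := coordB_pointB p hx
  open_source := isOpen_sourceB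
  open_target := isOpen_slab _ _
  continuousOn_toFun := by
    refine continuousOn_of_mk isOpen_sourceB fun x hx => ContinuousAt.continuousWithinAt ?_
    have hx := (coordB_mem_iff x).1 hx
    rcases lt_or_gt_of_ne hx with h | h
    · have hc : ContinuousAt (fun x : PuncturedSpace k × Set.Icc (0 : ℝ) Real.pi =>
          (x.1.1, (x.2 : ℝ))) x := by fun_prop
      refine hc.congr ?_
      filter_upwards [(isOpen_lt (by fun_prop) (by fun_prop) :
        IsOpen {y : PuncturedSpace k × Set.Icc (0 : ℝ) Real.pi | (y.2 : ℝ) < Real.pi / 2}).mem_nhds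
        h] with y hy
      exact (if_pos hy).symm
    · have hc : ContinuousAt (fun x : PuncturedSpace k × Set.Icc (0 : ℝ) Real.pi =>
          (-x.1.1, (x.2 : ℝ) - Real.pi)) x := by fun_prop
      refine hc.congr ?_
      filter_upwards [(isOpen_lt (by fun_prop) (by fun_prop) :
        IsOpen {y : PuncturedSpace k × Set.Icc (0 : ℝ) Real.pi | Real.pi / 2 < (y.2 : ℝ)}).mem_nhds
        h] with y hy
      exact (if_neg (not_lt.2 (le_of_lt hy))).symm
  continuousOn_invFun := by
    have h1 := continuousOn_point p
    have h2 : ContinuousOn (fun x : (Fin k → ℝ) × ℝ => point p (-x.1) (x.2 + Real.pi))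
        {x | x.1 ≠ 0} :=
      h1.comp (f := fun x : (Fin k → ℝ) × ℝ => (-x.1, x.2 + Real.pi)) (by fun_prop)
        fun x hx => neg_ne_zero.2 hx
    refine ContinuousOn.if (p := fun x : (Fin k → ℝ) × ℝ => 0 ≤ x.2) ?_
      (h1.mono fun x hx => hx.1.1) (h2.mono fun x hx => hx.1.1)
    rintro ⟨X, t⟩ ⟨⟨hX, -⟩, ht⟩
    obtain rfl : (0 : ℝ) = t := frontier_le_subset_eq continuous_const continuous_snd ht
    have hp := point_eq p (⟨X, hX⟩, ⟨0, le_rfl, Real.pi_pos.le⟩)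
    have hq := point_eq p (⟨-X, neg_ne_zero.2 hX⟩, ⟨Real.pi, Real.pi_pos.le, le_rfl⟩)
    dsimp only at hp hq ⊢
    rw [zero_add, hp, hq]
    exact mk_eq rfl rfl rfl

theorem coordB_point (p : PuncturedTorus k) {x : (Fin k → ℝ) × ℝ} (hx : x ∈ slab k 0 Real.pi) :
    coordB (point p x.1 x.2) =
      if x.2 < Real.pi / 2 then x else (-x.1, x.2 - Real.pi) := by
  have h := point_eq p (⟨x.1, hx.1⟩, ⟨x.2, hx.2.1.le, hx.2.2.le⟩)
  dsimp only at h
  rw [h, coordB_mk]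

theorem coordA_pointB (p : PuncturedTorus k) {x : (Fin k → ℝ) × ℝ}
    (hx : x ∈ slab k (-(Real.pi / 2)) (Real.pi / 2)) (h0 : x.2 ≠ 0) :
    coordA (pointB p x.1 x.2) = if 0 < x.2 then x else (-x.1, x.2 + Real.pi) := by
  obtain ⟨hX, h1, h2⟩ := hx
  have := Real.pi_pos
  rcases lt_or_gt_of_ne h0 with h | h
  · rw [pointB, if_neg (not_le.2 h), if_neg (not_lt.2 h.le)]
    exact coordA_point p (x := (-x.1, x.2 + Real.pi))
      ⟨neg_ne_zero.2 hX, by dsimp only; linarith, by dsimp only; linarith⟩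
  · rw [pointB, if_pos h.le, if_pos h]
    exact coordA_point p ⟨hX, h, by linarith⟩

/-- A map that near each point of `s` is one of two smooth maps, according to the position of
`x.2` relative to `c`, is smooth on `s`. -/
theorem contDiffOn_of_cases {E F : Type*} [NormedAddCommGroup E] [NormedSpace ℝ E]
    [NormedAddCommGroup F] [NormedSpace ℝ F] {f g₁ g₂ : E × ℝ → F} {s : Set (E × ℝ)}
    (hs : IsOpen s) (c : ℝ) (hc : ∀ x ∈ s, x.2 ≠ c) (h₁ : ContDiff ℝ ∞ g₁) (h₂ : ContDiff ℝ ∞ g₂)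
    (hf₁ : ∀ x ∈ s, x.2 < c → f x = g₁ x) (hf₂ : ∀ x ∈ s, c < x.2 → f x = g₂ x) :
    ContDiffOn ℝ ∞ f s := by
  intro x hx
  refine ContDiffAt.contDiffWithinAt ?_
  rcases lt_or_gt_of_ne (hc x hx) with h | h
  · refine h₁.contDiffAt.congr_of_eventuallyEq ?_
    filter_upwards [hs.mem_nhds hx, (isOpen_lt continuous_snd continuous_const).mem_nhds h]
      with y hy hy' using hf₁ y hy hy'
  · refine h₂.contDiffAt.congr_of_eventuallyEq ?_
    filter_upwards [hs.mem_nhds hx, (isOpen_lt continuous_const continuous_snd).mem_nhds h]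
      with y hy hy' using hf₂ y hy hy'

/-- The smooth structure of the mapping torus, given by the two charts above. -/
instance : ChartedSpace ((Fin k → ℝ) × ℝ) (PuncturedTorus k) where
  atlas := Set.range chartA ∪ Set.range chartB
  chartAt p := open Classical in if p ∈ (chartB p).source then chartB p else chartA p
  mem_chart_source p := by
    split_ifs with h
    · exact h
    · obtain ⟨x, rfl⟩ : ∃ x, mk x = p := Quot.exists_rep p
      have hx : (x.2 : ℝ) = Real.pi / 2 := by
        by_contra hx
        exact h ((coordB_mem_iff x).2 hx)
      refine (coordA_mem_iff x).2 ?_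
      rw [hx]
      exact ⟨half_pos Real.pi_pos, half_lt_self Real.pi_pos⟩
  chart_mem_atlas p := by
    split_ifs
    · exact Or.inr ⟨p, rfl⟩
    · exact Or.inl ⟨p, rfl⟩

instance : IsManifold 𝓘(ℝ, (Fin k → ℝ) × ℝ) ∞ (PuncturedTorus k) := by
  refine isManifold_of_contDiffOn _ _ _ ?_
  intro e e' he he'
  have hs : 𝓘(ℝ, (Fin k → ℝ) × ℝ).symm ⁻¹' (e.symm ≫ₕ e').source ∩
      Set.range 𝓘(ℝ, (Fin k → ℝ) × ℝ) = (e.symm ≫ₕ e').source := by simp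
  rw [hs]
  have ho := (e.symm ≫ₕ e').open_source
  rcases he with ⟨p, rfl⟩ | ⟨p, rfl⟩ <;> rcases he' with ⟨q, rfl⟩ | ⟨q, rfl⟩
  · exact contDiffOn_id.congr fun x hx => coordA_point p hx.1
  · refine contDiffOn_of_cases ho (Real.pi / 2) (g₁ := id)
      (g₂ := fun x => (-x.1, x.2 - Real.pi)) ?_ contDiff_id (by fun_prop) ?_ ?_
    · rintro x ⟨hx, hx'⟩ h
      have h' : coordB (point p x.1 x.2) ∈ slab k (-(Real.pi / 2)) (Real.pi / 2) := hx'
      rw [coordB_point p hx, if_neg (not_lt.2 h.ge)] at h'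
      have := h'.2.1
      dsimp only at this
      linarith
    · exact fun x hx h => (coordB_point p hx.1).trans (if_pos h)
    · exact fun x hx h => (coordB_point p hx.1).trans (if_neg (not_lt.2 h.le))
  · have hne : ∀ x ∈ ((chartB p).symm ≫ₕ chartA q).source, x.2 ≠ 0 := by
      rintro x ⟨hx, hx'⟩ h
      have h' : coordA (pointB p x.1 x.2) ∈ slab k 0 Real.pi := hx'
      have hp := point_eq p (⟨x.1, hx.1⟩, ⟨0, le_rfl, Real.pi_pos.le⟩)
      dsimp only at hp
      rw [h, pointB, if_pos le_rfl, hp, coordA_mem_iff] at h'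
      exact lt_irrefl _ h'.1
    refine contDiffOn_of_cases ho 0 (g₁ := fun x => (-x.1, x.2 + Real.pi)) (g₂ := id)
      hne (by fun_prop) contDiff_id ?_ ?_
    · exact fun x hx h => (coordA_pointB p hx.1 (hne x hx)).trans (if_neg (not_lt.2 h.le))
    · exact fun x hx h => (coordA_pointB p hx.1 (hne x hx)).trans (if_pos h)
  · exact contDiffOn_id.congr fun x hx => coordB_pointB p hx.1

end PuncturedTorus

/-- The `n`-tuple `(0, e^{iθ} x₁, …, e^{iθ} xₙ₋₁)`, that is `e^{iθ} X` with a first vertex `0`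
prepended. -/
def rotatedSegment (n : ℕ) (X : Fin (n - 1) → ℝ) (θ : ℝ) : Fin n → ℂ := fun j =>
  if h : (j : ℕ) = 0 then 0
  else Complex.exp (θ * Complex.I) * X ⟨(j : ℕ) - 1, by omega⟩

end

/-! A pointed segment is a nonzero vector with first entry 0 whose entries lie on one real line
through 0. Where the entry `Z j.succ` is nonzero, this says that `Z 0 = 0` and that every ratio `Z i
/ Z j.succ` is real: `n` real equations on the `2n` real coordinates. `ratioChart j` uses the ratios
as coordinates and shuffles the remaining ones so that the equations become the vanishing of all
imaginary parts. These slice charts, fed into `SliceAtlas`, yield the manifold structure and the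
smooth embedding.

A line through 0 is `e^{iθ}ℝ`, with `θ` in `[0, π]` unique up to exchanging 0 and π, which replaces
`X` by `-X` because `e^{iπ} = -1`. Hence `toSegments` is a bijection. In each chart of the torus it
reads `(X, θ) ↦ e^{iθ} X`, and smoothness into the submanifold can be tested in `ℂⁿ`. For the
inverse, a nonzero entry determines `θ` through an arctangent, and `X` is the real part of `e^{-iθ}
Z`; these formulas (`polarA`, `polarB`) are smooth on open subsets of `ℂⁿ`. -/

noncomputable section

/-! ### Submanifold structure from slice charts -/

/-- A family of charts of the ambient space `V`, smooth of class `n` in both directions, that cover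
`S` and in which `S` is given by the vanishing of the second component of `L.symm`. -/
structure SliceAtlas {V E F : Type*} [NormedAddCommGroup V] [NormedSpace ℝ V]
    [NormedAddCommGroup E] [NormedSpace ℝ E] [NormedAddCommGroup F] [NormedSpace ℝ F]
    (L : (E × F) ≃L[ℝ] V) (n : ℕ∞ω) (S : Set V) where
  ι : Type
  chart : ι → OpenPartialHomeomorph V V
  contDiffOn_chart : ∀ i, ContDiffOn ℝ n (chart i) (chart i).source
  contDiffOn_symm : ∀ i, ContDiffOn ℝ n (chart i).symm (chart i).target
  mem_iff : ∀ i, ∀ z ∈ (chart i).source, z ∈ S ↔ (L.symm (chart i z)).2 = 0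
  index : S → ι
  mem_source : ∀ z : S, (z : V) ∈ (chart (index z)).source

namespace SliceAtlas

variable {V E F : Type*} [NormedAddCommGroup V] [NormedSpace ℝ V]
  [NormedAddCommGroup E] [NormedSpace ℝ E] [NormedAddCommGroup F] [NormedSpace ℝ F]
  {L : (E × F) ≃L[ℝ] V} {n : ℕ∞ω} {S : Set V} (A : SliceAtlas L n S)

theorem symm_mem (i : A.ι) {u : E} (hu : L (u, 0) ∈ (A.chart i).target) :
    (A.chart i).symm (L (u, 0)) ∈ S := by
  rw [A.mem_iff i _ ((A.chart i).map_target hu), (A.chart i).right_inv hu]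
  simp

theorem apply_fst_zero (i : A.ι) {z : V} (hz : z ∈ (A.chart i).source) (hS : z ∈ S) :
    L ((L.symm (A.chart i z)).1, 0) = A.chart i z := by
  rw [← (A.mem_iff i z hz).1 hS]
  simp

/-- The chart of `S` induced by an ambient chart. The point `z₀` only serves as a value of the
inverse outside its domain. -/
def restrictedChart (i : A.ι) (z₀ : S) : OpenPartialHomeomorph S E where
  toFun z := (L.symm (A.chart i z)).1
  invFun u := open Classical in
    if hu : (A.chart i).symm (L (u, 0)) ∈ S then ⟨_, hu⟩ else z₀
  source := Subtype.val ⁻¹' (A.chart i).source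
  target := {u | L (u, 0) ∈ (A.chart i).target}
  map_source' z hz := by
    simp only [Set.mem_ofPred_eq]
    rw [A.apply_fst_zero i hz z.2]
    exact (A.chart i).map_source hz
  map_target' u hu := by
    rw [dif_pos (A.symm_mem i hu)]
    exact (A.chart i).map_target hu
  left_inv' z hz := by
    have h : (A.chart i).symm (L ((L.symm (A.chart i z)).1, 0)) = z := by
      rw [A.apply_fst_zero i hz z.2, (A.chart i).left_inv hz]
    rw [dif_pos (by rw [h]; exact z.2)]
    exact Subtype.ext h
  right_inv' u hu := by
    rw [dif_pos (A.symm_mem i hu)]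
    dsimp only
    rw [(A.chart i).right_inv hu]
    simp
  open_source := (A.chart i).open_source.preimage continuous_subtype_val
  open_target := (A.chart i).open_target.preimage (by fun_prop)
  continuousOn_toFun := by
    have := (A.chart i).continuousOn.comp continuous_subtype_val.continuousOn
      (Set.mapsTo_preimage (Subtype.val : S → V) _)
    exact (continuous_fst.comp L.symm.continuous).comp_continuousOn this
  continuousOn_invFun := by
    rw [Topology.IsInducing.subtypeVal.continuousOn_iff]
    have : ContinuousOn (fun u : E => (A.chart i).symm (L (u, 0)))
        {u | L (u, 0) ∈ (A.chart i).target} :=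
      (A.chart i).continuousOn_symm.comp (by fun_prop) fun u hu => hu
    refine this.congr fun u hu => ?_
    simp only [Function.comp_apply]
    rw [dif_pos (A.symm_mem i hu)]

theorem coe_restrictedChart_symm (i : A.ι) (z₀ : S) {u : E}
    (hu : u ∈ (A.restrictedChart i z₀).target) :
    ((A.restrictedChart i z₀).symm u : V) = (A.chart i).symm (L (u, 0)) :=
  congrArg Subtype.val (dif_pos (A.symm_mem i hu))

/-- The atlas of restrictions to `S` of the ambient charts. -/
@[reducible] def chartedSpace : ChartedSpace E S where
  atlas := {c | ∃ i z₀, c = A.restrictedChart i z₀}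
  chartAt z := A.restrictedChart (A.index z) z
  mem_chart_source := A.mem_source
  chart_mem_atlas _ := ⟨_, _, rfl⟩

/-- A transition map is an ambient transition map preceded by the inclusion `u ↦ L (u, 0)` and
followed by a linear projection, hence smooth. -/
theorem isManifold :
    letI := A.chartedSpace
    IsManifold 𝓘(ℝ, E) n S := by
  let _ := A.chartedSpace
  refine isManifold_of_contDiffOn _ _ _ ?_
  rintro _ _ ⟨i, z, rfl⟩ ⟨j, w, rfl⟩
  have hsource : 𝓘(ℝ, E).symm ⁻¹' ((A.restrictedChart i z).symm ≫ₕ A.restrictedChart j w).source ∩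
      Set.range 𝓘(ℝ, E) = ((A.restrictedChart i z).symm ≫ₕ A.restrictedChart j w).source := by simp
  rw [hsource]
  set s := ((A.restrictedChart i z).symm ≫ₕ A.restrictedChart j w).source
  have hs : ∀ u ∈ s, (A.chart i).symm (L (u, 0)) ∈ (A.chart j).source := by
    intro u hu
    rw [← A.coe_restrictedChart_symm i z hu.1]
    exact hu.2
  have h1 : ContDiffOn ℝ n (fun u : E => (A.chart i).symm (L (u, 0))) s :=
    (A.contDiffOn_symm i).comp (L.contDiff.comp (by fun_prop)).contDiffOn fun u hu => hu.1
  have h2 : ContDiffOn ℝ n (fun u : E => (L.symm (A.chart j ((A.chart i).symm (L (u, 0))))).1) s :=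
    (contDiff_fst.comp L.symm.contDiff).comp_contDiffOn ((A.contDiffOn_chart j).comp h1 hs)
  refine h2.congr fun u hu => ?_
  change (L.symm (A.chart j ((A.restrictedChart i z).symm u : V))).1 = _
  rw [A.coe_restrictedChart_symm i z hu.1]

/-- In a slice chart and its restriction the inclusion reads `u ↦ L (u, 0)`, the normal form of an
immersion with complement `F`. The topology of `S` is the subspace topology, so the immersion is an
embedding. -/
theorem isSmoothEmbedding :
    letI := A.chartedSpace
    Manifold.IsSmoothEmbedding 𝓘(ℝ, E) 𝓘(ℝ, V) n (Subtype.val : S → V) := by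
  let _ := A.chartedSpace
  have := A.isManifold
  refine ⟨Manifold.IsImmersionOfComplement.isImmersion (F := F) fun z => ?_, .subtypeVal⟩
  refine .mk_of_continuousAt continuous_subtype_val.continuousAt L
    (A.restrictedChart (A.index z) z) (A.chart (A.index z)) (A.mem_source z) (A.mem_source z)
    (IsManifold.chart_mem_maximalAtlas z) ?_ ?_
  -- An ambient chart lies in the maximal atlas of `V` because it is smooth in both directions.
  · refine StructureGroupoid.mem_maximalAtlas_of_mem_groupoid _ ?_
    rw [contDiffGroupoid, mem_groupoid_of_pregroupoid]
    simpa [contDiffPregroupoid] using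
      ⟨A.contDiffOn_chart (A.index z), A.contDiffOn_symm (A.index z)⟩
  · intro u hu
    have hu' : u ∈ (A.restrictedChart (A.index z) z).target := by simpa using hu
    change A.chart (A.index z) ((A.restrictedChart (A.index z) z).symm u : V) = L (u, 0)
    rw [A.coe_restrictedChart_symm _ z hu', (A.chart (A.index z)).right_inv hu']

end SliceAtlas

/-! ### Slice charts for the pointed segments -/

/-- The only real line through `0` and `Z j` is `ℝ • Z j`, and lying on it means having a real ratio
to `Z j`. -/
theorem mem_pointedSegments_iff {k : ℕ} {Z : Fin (k + 1) → ℂ} {j : Fin (k + 1)} (hj : Z j ≠ 0) :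
    Z ∈ pointedSegments (k + 1) ↔ Z 0 = 0 ∧ ∀ i, (Z i / Z j).im = 0 := by
  constructor
  · rintro ⟨⟨hc, -⟩, h0⟩
    have h0 : Z 0 = 0 := h0 0 rfl
    refine ⟨h0, fun i => ?_⟩
    obtain ⟨v, hv⟩ := (collinear_iff_of_mem (k := ℝ) (Set.mem_range_self 0)).1 hc
    obtain ⟨r, hr⟩ := hv (Z i) ⟨i, rfl⟩
    obtain ⟨s, hs⟩ := hv (Z j) ⟨j, rfl⟩
    simp only [h0, vadd_eq_add, add_zero, Complex.real_smul] at hr hs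
    have hv : v ≠ 0 := by
      rintro rfl
      exact hj (by simpa using hs)
    rw [hr, hs, mul_div_mul_right _ _ hv, ← Complex.ofReal_div, Complex.ofReal_im]
  · rintro ⟨h0, h⟩
    refine ⟨⟨(collinear_iff_of_mem (k := ℝ) (Set.mem_range_self 0)).2 ⟨Z j, ?_⟩, j, 0, ?_⟩, ?_⟩
    · rintro _ ⟨i, rfl⟩
      refine ⟨(Z i / Z j).re, ?_⟩
      have : ((Z i / Z j).re : ℂ) = Z i / Z j := Complex.ext rfl (h i).symm
      rw [h0, vadd_eq_add, add_zero, Complex.real_smul, this, div_mul_cancel₀ _ hj]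
    · rwa [h0]
    · intro i hi
      rw [show i = 0 from Fin.ext hi, h0]

theorem exists_ne_zero_of_mem_pointedSegments {k : ℕ} {Z : Fin (k + 1) → ℂ}
    (hZ : Z ∈ pointedSegments (k + 1)) : ∃ j : Fin k, Z j.succ ≠ 0 := by
  by_contra! h
  obtain ⟨⟨-, i, j, hij⟩, h0⟩ := hZ
  have hz : ∀ i, Z i = 0 := Fin.cases (h0 0 rfl) h
  exact hij (by rw [hz i, hz j])

/-- Splitting of `ℂⁿ` into real and imaginary parts. -/
def complexSplitting (n : ℕ) :
    (EuclideanSpace ℝ (Fin n) × (Fin n → ℝ)) ≃L[ℝ] (Fin n → ℂ) :=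
  -- The real parts live in `EuclideanSpace`, the model space of `𝓡 n`; the imaginary parts only
  -- form a complement.
  LinearEquiv.toContinuousLinearEquiv
    { toFun := fun p i => ⟨p.1 i, p.2 i⟩
      invFun := fun Z => (WithLp.toLp 2 fun i => (Z i).re, fun i => (Z i).im)
      map_add' := fun _ _ => rfl
      map_smul' := fun r p => by
        funext i
        apply Complex.ext <;> simp
      left_inv := fun _ => rfl
      right_inv := fun _ => rfl }

theorem complexSplitting_symm_snd {n : ℕ} (Z : Fin n → ℂ) :
    ((complexSplitting n).symm Z).2 = fun i => (Z i).im := rfl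

/-- Coordinates of `ℂᵏ⁺¹` near the points with `Z (j + 1) ≠ 0`, straightening the set of tuples
whose first entry is `0` and whose other entries are real multiples of `Z (j + 1)`. -/
def ratioChart {k : ℕ} (j : Fin k) :
    OpenPartialHomeomorph (Fin (k + 1) → ℂ) (Fin (k + 1) → ℂ) where
  -- Slots `0` and `j.succ` hold the real and the imaginary parts of `Z j.succ` and `Z 0`, regrouped
  -- so that `Z 0` occupies the imaginary parts of both slots. The condition `Z 0 = 0` thus becomes
  -- two vanishing imaginary parts, like the reality of the ratios in the other slots.
  toFun Z i := if i = 0 then (Z j.succ).re + (Z 0).re * Complex.I else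
    if i = j.succ then (Z j.succ).im + (Z 0).im * Complex.I else Z i / Z j.succ
  invFun W i := if i = 0 then (W 0).im + (W j.succ).im * Complex.I else
    if i = j.succ then (W 0).re + (W j.succ).re * Complex.I else
      W i * ((W 0).re + (W j.succ).re * Complex.I)
  source := {Z | Z j.succ ≠ 0}
  target := {W | ((W 0).re + (W j.succ).re * Complex.I : ℂ) ≠ 0}
  map_source' Z hZ := by simpa [Fin.succ_ne_zero] using hZ
  map_target' W hW := by simpa [Fin.succ_ne_zero] using hW
  left_inv' Z hZ := by
    have hZ : Z j.succ ≠ 0 := hZ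
    funext i
    by_cases h0 : i = 0
    · subst h0
      simp [Fin.succ_ne_zero]
    by_cases hj : i = j.succ
    · subst hj
      simp [Fin.succ_ne_zero]
    · simp [Fin.succ_ne_zero, h0, hj, hZ]
  right_inv' W hW := by
    have hW : ((W 0).re + (W j.succ).re * Complex.I : ℂ) ≠ 0 := hW
    funext i
    by_cases h0 : i = 0
    · subst h0
      simp [Fin.succ_ne_zero]
    by_cases hj : i = j.succ
    · subst hj
      simp [Fin.succ_ne_zero]
    · simp [Fin.succ_ne_zero, h0, hj, hW]
  open_source := isOpen_ne_fun (by fun_prop) (by fun_prop)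
  open_target := isOpen_ne_fun (by fun_prop) (by fun_prop)
  continuousOn_toFun := by
    refine continuousOn_pi.2 fun i => ?_
    split_ifs
    · fun_prop
    · fun_prop
    · exact ContinuousOn.div (by fun_prop) (by fun_prop) fun Z hZ => hZ
  continuousOn_invFun := by
    refine continuousOn_pi.2 fun i => ?_
    split_ifs <;> fun_prop

theorem contDiff_re_add_im {V : Type*} [NormedAddCommGroup V] [NormedSpace ℝ V] {f g : V → ℝ}
    {m : ℕ∞ω} (hf : ContDiff ℝ m f) (hg : ContDiff ℝ m g) :
    ContDiff ℝ m fun v => (f v + g v * Complex.I : ℂ) :=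
  (Complex.ofRealCLM.contDiff.comp hf).add
    ((Complex.ofRealCLM.contDiff.comp hg).mul contDiff_const)

theorem contDiff_re_apply {n : ℕ} {m : ℕ∞ω} (i : Fin n) :
    ContDiff ℝ m fun Z : Fin n → ℂ => (Z i).re :=
  Complex.reCLM.contDiff.comp (contDiff_apply ℝ ℂ i)

theorem contDiff_im_apply {n : ℕ} {m : ℕ∞ω} (i : Fin n) :
    ContDiff ℝ m fun Z : Fin n → ℂ => (Z i).im :=
  Complex.imCLM.contDiff.comp (contDiff_apply ℝ ℂ i)

theorem contDiffOn_ratioChart {k : ℕ} {m : ℕ∞ω} (j : Fin k) :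
    ContDiffOn ℝ m (ratioChart j) (ratioChart j).source := by
  refine contDiffOn_pi.2 fun i => ?_
  change ContDiffOn ℝ m (fun Z : Fin (k + 1) → ℂ => ite _ _ _) _
  split_ifs
  · exact (contDiff_re_add_im (contDiff_re_apply _) (contDiff_re_apply _)).contDiffOn
  · exact (contDiff_re_add_im (contDiff_im_apply _) (contDiff_im_apply _)).contDiffOn
  · exact (contDiff_apply ℝ ℂ i).contDiffOn.mul
      ((contDiff_apply ℝ ℂ j.succ).contDiffOn.inv fun Z hZ => hZ)

theorem contDiff_ratioChart_symm {k : ℕ} {m : ℕ∞ω} (j : Fin k) :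
    ContDiff ℝ m (ratioChart j).symm := by
  refine contDiff_pi.2 fun i => ?_
  change ContDiff ℝ m (fun W : Fin (k + 1) → ℂ => ite _ _ _)
  split_ifs
  · exact contDiff_re_add_im (contDiff_im_apply _) (contDiff_im_apply _)
  · exact contDiff_re_add_im (contDiff_re_apply _) (contDiff_re_apply _)
  · exact (contDiff_apply ℝ ℂ i).mul
      (contDiff_re_add_im (contDiff_re_apply _) (contDiff_re_apply _))

/-- The imaginary parts in slots `0` and `j.succ` are those that encode `Z 0`; the ratios missing
there are `0` (once `Z 0 = 0`) and `1`, which are real anyway. -/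
theorem mem_pointedSegments_iff_ratioChart {k : ℕ} (j : Fin k) {Z : Fin (k + 1) → ℂ}
    (hZ : Z j.succ ≠ 0) :
    Z ∈ pointedSegments (k + 1) ↔ ((complexSplitting (k + 1)).symm (ratioChart j Z)).2 = 0 := by
  rw [mem_pointedSegments_iff hZ, complexSplitting_symm_snd]
  have h1 : (ratioChart j Z 0).im = (Z 0).re := by simp [ratioChart]
  have h2 : (ratioChart j Z j.succ).im = (Z 0).im := by simp [ratioChart, Fin.succ_ne_zero]
  have h3 : ∀ i, i ≠ 0 → i ≠ j.succ → ratioChart j Z i = Z i / Z j.succ := fun i h h' => by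
    simp [ratioChart, h, h']
  constructor
  · rintro ⟨h0, h⟩
    funext i
    by_cases hi : i = 0
    · subst hi
      simp [h1, h0]
    by_cases hj : i = j.succ
    · subst hj
      simp [h2, h0]
    · rw [h3 i hi hj, h i, Pi.zero_apply]
  · intro h
    have h0 : Z 0 = 0 := Complex.ext (h1 ▸ congrFun h 0) (h2 ▸ congrFun h j.succ)
    refine ⟨h0, fun i => ?_⟩
    by_cases hi : i = 0
    · simp [hi, h0]
    by_cases hj : i = j.succ
    · simp [hj, div_self hZ]
    · rw [← h3 i hi hj]
      exact congrFun h i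

/-- The slice atlas of `𝕄(k + 1)`. -/
def pointedSegmentsAtlas (k : ℕ) :
    SliceAtlas (complexSplitting (k + 1)) ∞ (pointedSegments (k + 1)) where
  ι := Fin k
  chart := ratioChart
  contDiffOn_chart := contDiffOn_ratioChart
  contDiffOn_symm j := (contDiff_ratioChart_symm j).contDiffOn
  mem_iff j _ hZ := mem_pointedSegments_iff_ratioChart j hZ
  index Z := (exists_ne_zero_of_mem_pointedSegments Z.2).choose
  mem_source Z := (exists_ne_zero_of_mem_pointedSegments Z.2).choose_spec

/-! ### The parametrization by rotated real vectors -/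

theorem rotatedSegment_zero {k : ℕ} (X : Fin k → ℝ) (θ : ℝ) :
    rotatedSegment (k + 1) X θ 0 = 0 := rfl

theorem rotatedSegment_succ {k : ℕ} (X : Fin k → ℝ) (θ : ℝ) (i : Fin k) :
    rotatedSegment (k + 1) X θ i.succ = Complex.exp (θ * Complex.I) * X i := rfl

theorem rotatedSegment_ext {k : ℕ} {X : Fin k → ℝ} {θ : ℝ} {Z : Fin (k + 1) → ℂ} (h0 : Z 0 = 0)
    (h : ∀ i : Fin k, Complex.exp (θ * Complex.I) * X i = Z i.succ) :
    rotatedSegment (k + 1) X θ = Z :=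
  funext (Fin.cases h0.symm h)

theorem rotatedSegment_neg_sub_pi {k : ℕ} (X : Fin k → ℝ) (θ : ℝ) :
    rotatedSegment (k + 1) (-X) (θ - Real.pi) = rotatedSegment (k + 1) X θ := by
  refine rotatedSegment_ext rfl fun i => ?_
  rw [rotatedSegment_succ]
  push_cast
  rw [sub_mul, Complex.exp_sub, Complex.exp_pi_mul_I]
  simp [div_neg]

theorem rotatedSegment_neg_add_pi {k : ℕ} (X : Fin k → ℝ) (θ : ℝ) :
    rotatedSegment (k + 1) (-X) (θ + Real.pi) = rotatedSegment (k + 1) X θ := by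
  rw [← rotatedSegment_neg_sub_pi, neg_neg, add_sub_cancel_right]

theorem rotatedSegment_mem {k : ℕ} {X : Fin k → ℝ} (hX : X ≠ 0) (θ : ℝ) :
    rotatedSegment (k + 1) X θ ∈ pointedSegments (k + 1) := by
  obtain ⟨j, hj⟩ := Function.ne_iff.1 hX
  have hj : (X j : ℂ) ≠ 0 := Complex.ofReal_ne_zero.2 hj
  refine (mem_pointedSegments_iff (j := j.succ) ?_).2 ⟨rfl, Fin.cases ?_ fun i => ?_⟩
  · exact mul_ne_zero (Complex.exp_ne_zero _) hj
  · simp [rotatedSegment_zero]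
  · rw [rotatedSegment_succ, rotatedSegment_succ,
      mul_div_mul_left _ _ (Complex.exp_ne_zero _), ← Complex.ofReal_div, Complex.ofReal_im]

theorem contDiff_rotatedSegment {k : ℕ} {m : ℕ∞ω} :
    ContDiff ℝ m fun x : (Fin k → ℝ) × ℝ => rotatedSegment (k + 1) x.1 x.2 := by
  refine contDiff_pi.2 (Fin.cases contDiff_const fun i => ?_)
  simp only [rotatedSegment_succ]
  exact (((Complex.ofRealCLM.contDiff.comp contDiff_snd).mul contDiff_const).cexp).mul
    (Complex.ofRealCLM.contDiff.comp ((contDiff_apply ℝ ℝ i).comp contDiff_fst))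

/-! ### Signed polar coordinates and local inverses -/

/-- Polar form with a signed radius: the angle is that of the line `ℝz`, taken in `(-π/2, π/2)`, and
the radius has the sign of `z.re`. No branch of the argument is needed. -/
theorem Complex.eq_mul_exp_arctan {z : ℂ} (hz : z.re ≠ 0) :
    z = (z.re / Real.cos (Real.arctan (z.im / z.re)) : ℝ) *
      Complex.exp (Real.arctan (z.im / z.re) * Complex.I) := by
  have hc := (Real.cos_arctan_pos (z.im / z.re)).ne'
  have ht := Real.tan_mul_cos hc
  rw [Real.tan_arctan] at ht
  apply Complex.ext
  · rw [Complex.re_ofReal_mul, Complex.exp_ofReal_mul_I_re, div_mul_cancel₀ _ hc]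
  · rw [Complex.im_ofReal_mul, Complex.exp_ofReal_mul_I_im, ← ht]
    field_simp

/-- The counterpart for non-real `z`: the angle of the line is taken in `(0, π)` and the radius has
the sign of `z.im`. -/
theorem Complex.eq_mul_exp_pi_div_two_sub_arctan {z : ℂ} (hz : z.im ≠ 0) :
    z = (z.im / Real.cos (Real.arctan (z.re / z.im)) : ℝ) *
      Complex.exp ((Real.pi / 2 - Real.arctan (z.re / z.im) : ℝ) * Complex.I) := by
  have hc := (Real.cos_arctan_pos (z.re / z.im)).ne'
  have ht := Real.tan_mul_cos hc
  rw [Real.tan_arctan] at ht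
  apply Complex.ext
  · rw [Complex.re_ofReal_mul, Complex.exp_ofReal_mul_I_re, Real.cos_pi_div_two_sub, ← ht]
    field_simp
  · rw [Complex.im_ofReal_mul, Complex.exp_ofReal_mul_I_im, Real.sin_pi_div_two_sub,
      div_mul_cancel₀ _ hc]

/-- The real parts of the entries of `Z` after the first one, rotated by `-t`. -/
def derotate {k : ℕ} (t : ℝ) (Z : Fin (k + 1) → ℂ) : Fin k → ℝ := fun i =>
  (Complex.exp (-(t * Complex.I)) * Z i.succ).re

/-- One nonzero entry on the line `e^{it}ℝ` forces every entry onto it, so `e^{-it} Z` is real and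
taking real parts loses nothing. -/
theorem rotatedSegment_derotate {k : ℕ} {Z : Fin (k + 1) → ℂ} (hZ : Z ∈ pointedSegments (k + 1))
    {j : Fin k} (hj : Z j.succ ≠ 0) {r t : ℝ} (h : Z j.succ = r * Complex.exp (t * Complex.I)) :
    rotatedSegment (k + 1) (derotate t Z) t = Z := by
  obtain ⟨h0, him⟩ := (mem_pointedSegments_iff hj).1 hZ
  refine rotatedSegment_ext h0 fun i => ?_
  obtain ⟨s, hs⟩ : ∃ s : ℝ, Z i.succ = s * Complex.exp (t * Complex.I) := by
    refine ⟨(Z i.succ / Z j.succ).re * r, ?_⟩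
    have : ((Z i.succ / Z j.succ).re : ℂ) = Z i.succ / Z j.succ := Complex.ext rfl (him _).symm
    rw [Complex.ofReal_mul, this, mul_assoc, ← h, div_mul_cancel₀ _ hj]
  have hd : derotate t Z i = s := by
    rw [derotate, hs, mul_left_comm, ← Complex.exp_add, neg_add_cancel, Complex.exp_zero, mul_one,
      Complex.ofReal_re]
  rw [hd, hs, mul_comm]

theorem derotate_ne_zero {k : ℕ} {Z : Fin (k + 1) → ℂ} (hZ : Z ∈ pointedSegments (k + 1)) {t : ℝ}
    (h : rotatedSegment (k + 1) (derotate t Z) t = Z) : derotate t Z ≠ 0 := by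
  intro h0
  obtain ⟨j, hj⟩ := exists_ne_zero_of_mem_pointedSegments hZ
  refine hj ?_
  rw [← h, h0, rotatedSegment_succ]
  simp

/-- The point of `ℝᵏ × (-π / 2, π / 2)` with image `Z` under `rotatedSegment`, if the real part of
the entry `j + 1` of `Z` is not `0`. -/
def polarB {k : ℕ} (j : Fin k) (Z : Fin (k + 1) → ℂ) : (Fin k → ℝ) × ℝ :=
  (derotate (Real.arctan ((Z j.succ).im / (Z j.succ).re)) Z,
    Real.arctan ((Z j.succ).im / (Z j.succ).re))

/-- The point of `ℝᵏ × (0, π)` with image `Z` under `rotatedSegment`, if the imaginary part of the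
entry `j + 1` of `Z` is not `0`. -/
def polarA {k : ℕ} (j : Fin k) (Z : Fin (k + 1) → ℂ) : (Fin k → ℝ) × ℝ :=
  (derotate (Real.pi / 2 - Real.arctan ((Z j.succ).re / (Z j.succ).im)) Z,
    Real.pi / 2 - Real.arctan ((Z j.succ).re / (Z j.succ).im))

/-- Since `derotate` takes real parts, it makes sense off the segments too, so smoothness can be
checked in the ambient space. -/
theorem contDiffAt_derotate {k : ℕ} {m : ℕ∞ω} {f : (Fin (k + 1) → ℂ) → ℝ} {Z : Fin (k + 1) → ℂ}
    (hf : ContDiffAt ℝ m f Z) : ContDiffAt ℝ m (fun Z => derotate (f Z) Z) Z := by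
  refine contDiffAt_pi.2 fun i => ?_
  exact Complex.reCLM.contDiff.contDiffAt.comp Z
    ((((Complex.ofRealCLM.contDiff.contDiffAt.comp Z hf).mul contDiffAt_const).neg.cexp).mul
      (contDiff_apply ℝ ℂ _).contDiffAt)

theorem contDiffAt_polarB {k : ℕ} {m : ℕ∞} {j : Fin k} {Z : Fin (k + 1) → ℂ}
    (hZ : (Z j.succ).re ≠ 0) : ContDiffAt ℝ m (polarB j) Z := by
  have h : ContDiffAt ℝ m (fun Z : Fin (k + 1) → ℂ =>
      Real.arctan ((Z j.succ).im / (Z j.succ).re)) Z :=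
    ((contDiff_im_apply _).contDiffAt.div (contDiff_re_apply _).contDiffAt hZ).arctan
  exact (contDiffAt_derotate h).prodMk h

theorem contDiffAt_polarA {k : ℕ} {m : ℕ∞} {j : Fin k} {Z : Fin (k + 1) → ℂ}
    (hZ : (Z j.succ).im ≠ 0) : ContDiffAt ℝ m (polarA j) Z := by
  have h : ContDiffAt ℝ m (fun Z : Fin (k + 1) → ℂ =>
      Real.pi / 2 - Real.arctan ((Z j.succ).re / (Z j.succ).im)) Z :=
    contDiffAt_const.sub
      ((contDiff_re_apply _).contDiffAt.div (contDiff_im_apply _).contDiffAt hZ).arctan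
  exact (contDiffAt_derotate h).prodMk h

theorem rotatedSegment_polarB {k : ℕ} {Z : Fin (k + 1) → ℂ} (hZ : Z ∈ pointedSegments (k + 1))
    {j : Fin k} (hj : (Z j.succ).re ≠ 0) :
    rotatedSegment (k + 1) (polarB j Z).1 (polarB j Z).2 = Z :=
  rotatedSegment_derotate hZ (fun h => hj (by rw [h, Complex.zero_re]))
    (Complex.eq_mul_exp_arctan hj)

theorem rotatedSegment_polarA {k : ℕ} {Z : Fin (k + 1) → ℂ} (hZ : Z ∈ pointedSegments (k + 1))
    {j : Fin k} (hj : (Z j.succ).im ≠ 0) :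
    rotatedSegment (k + 1) (polarA j Z).1 (polarA j Z).2 = Z :=
  rotatedSegment_derotate hZ (fun h => hj (by rw [h, Complex.zero_im]))
    (Complex.eq_mul_exp_pi_div_two_sub_arctan hj)

theorem polarB_mem_slab {k : ℕ} {Z : Fin (k + 1) → ℂ} (hZ : Z ∈ pointedSegments (k + 1))
    {j : Fin k} (hj : (Z j.succ).re ≠ 0) :
    polarB j Z ∈ PuncturedTorus.slab k (-(Real.pi / 2)) (Real.pi / 2) :=
  ⟨derotate_ne_zero hZ (rotatedSegment_polarB hZ hj), Real.neg_pi_div_two_lt_arctan _,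
    Real.arctan_lt_pi_div_two _⟩

theorem polarA_mem_slab {k : ℕ} {Z : Fin (k + 1) → ℂ} (hZ : Z ∈ pointedSegments (k + 1))
    {j : Fin k} (hj : (Z j.succ).im ≠ 0) :
    polarA j Z ∈ PuncturedTorus.slab k 0 Real.pi := by
  have h1 := Real.neg_pi_div_two_lt_arctan ((Z j.succ).re / (Z j.succ).im)
  have h2 := Real.arctan_lt_pi_div_two ((Z j.succ).re / (Z j.succ).im)
  refine ⟨derotate_ne_zero hZ (rotatedSegment_polarA hZ hj), ?_, ?_⟩
  · dsimp only [polarA]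
    linarith
  · dsimp only [polarA]
    linarith

/-! ### The diffeomorphism from the mapping torus -/

namespace PuncturedTorus

variable {k : ℕ}

/-- The map `[X, θ] ↦ (0, e^{iθ} X)`. -/
def toSegments : PuncturedTorus k → pointedSegments (k + 1) :=
  Quot.lift (fun p => ⟨rotatedSegment (k + 1) p.1.1 p.2, rotatedSegment_mem p.1.2 p.2⟩) (by
    rintro p q ⟨h1, h2, h3⟩
    refine Subtype.ext ?_
    dsimp only
    rw [h1, h2, h3, ← rotatedSegment_neg_add_pi, zero_add])

theorem continuous_toSegments : Continuous (toSegments (k := k)) := by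
  refine continuous_quot_lift _ (Continuous.subtype_mk ?_ _)
  exact (contDiff_rotatedSegment (m := 0)).continuous.comp
    (f := fun p : PuncturedSpace k × Set.Icc (0 : ℝ) Real.pi => (p.1.1, (p.2 : ℝ))) (by fun_prop)

theorem coe_toSegments_point (p : PuncturedTorus k) {X : Fin k → ℝ} (hX : X ≠ 0) {t : ℝ}
    (h0 : 0 ≤ t) (h1 : t ≤ Real.pi) :
    (toSegments (point p X t) : Fin (k + 1) → ℂ) = rotatedSegment (k + 1) X t := by
  have h := point_eq p (⟨X, hX⟩, ⟨t, h0, h1⟩)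
  dsimp only at h
  rw [h]
  rfl

theorem coe_toSegments_pointB (p : PuncturedTorus k) {x : (Fin k → ℝ) × ℝ}
    (hx : x ∈ slab k (-(Real.pi / 2)) (Real.pi / 2)) :
    (toSegments (pointB p x.1 x.2) : Fin (k + 1) → ℂ) = rotatedSegment (k + 1) x.1 x.2 := by
  obtain ⟨hX, h1, h2⟩ := hx
  have := Real.pi_pos
  unfold pointB
  split_ifs with h
  · exact coe_toSegments_point p hX h (by linarith)
  · rw [coe_toSegments_point p (neg_ne_zero.2 hX) (by linarith) (by linarith),
      rotatedSegment_neg_add_pi]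

theorem rotatedSegment_coordA {p : PuncturedTorus k} (hp : coordA p ∈ slab k 0 Real.pi) :
    rotatedSegment (k + 1) (coordA p).1 (coordA p).2 = toSegments p := by
  obtain ⟨x, rfl⟩ : ∃ x, mk x = p := Quot.exists_rep p
  rw [coordA_mk, if_pos ((coordA_mem_iff x).1 hp)]
  rfl

theorem rotatedSegment_coordB (p : PuncturedTorus k) :
    rotatedSegment (k + 1) (coordB p).1 (coordB p).2 = toSegments p := by
  obtain ⟨x, rfl⟩ : ∃ x, mk x = p := Quot.exists_rep p
  rw [coordB_mk]
  split_ifs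
  · rfl
  · exact rotatedSegment_neg_sub_pi _ _

theorem toSegments_injective : Function.Injective (toSegments (k := k)) := by
  -- By symmetry `s ≤ t`. Then `X = e^{i(t-s)} Y` with both vectors real and `Y` nonzero, so `sin (t
  -- - s) = 0` with `t - s` in `[0, π]`: either `s = t`, or `s = 0` and `t = π`, which is the gluing
  -- relation.
  have key : ∀ (X Y : PuncturedSpace k) (s t : Set.Icc (0 : ℝ) Real.pi), (s : ℝ) ≤ t →
      rotatedSegment (k + 1) X.1 s = rotatedSegment (k + 1) Y.1 t → mk (X, s) = mk (Y, t) := by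
    intro X Y s t hst h
    have hi : ∀ i, (X.1 i : ℂ) =
        Complex.exp (((t : ℝ) - (s : ℝ) : ℝ) * Complex.I) * Y.1 i := by
      intro i
      have hs := congrFun h i.succ
      rw [rotatedSegment_succ, rotatedSegment_succ] at hs
      rw [Complex.ofReal_sub, sub_mul, Complex.exp_sub, div_mul_eq_mul_div, ← hs,
        mul_div_cancel_left₀ _ (Complex.exp_ne_zero _)]
    obtain ⟨j, hj⟩ := Function.ne_iff.1 Y.2
    have hsin : Real.sin (t - s) = 0 := by
      have := congrArg Complex.im (hi j)
      rw [Complex.im_mul_ofReal, Complex.exp_ofReal_mul_I_im, Complex.ofReal_im] at this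
      exact (mul_eq_zero.1 this.symm).resolve_right hj
    rcases hst.eq_or_lt with hst | hst
    · obtain rfl : s = t := Subtype.ext hst
      have : X = Y := Subtype.ext <| funext fun i => by simpa using hi i
      rw [this]
    · have hpi : Real.pi ≤ t - s := by
        by_contra! hlt
        exact (Real.sin_pos_of_pos_of_lt_pi (sub_pos.2 hst) hlt).ne' hsin
      have hs0 : (s : ℝ) = 0 := le_antisymm (by linarith [t.2.2]) s.2.1
      have ht : (t : ℝ) = Real.pi := le_antisymm t.2.2 (by linarith)
      refine mk_eq hs0 ht (funext fun i => ?_)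
      have := hi i
      rw [hs0, ht, sub_zero, Complex.exp_pi_mul_I] at this
      have : X.1 i = -Y.1 i := by exact_mod_cast (by simpa using this : (X.1 i : ℂ) = -Y.1 i)
      simp [this]
  rintro ⟨X, s⟩ ⟨Y, t⟩ h
  have h : rotatedSegment (k + 1) X.1 s = rotatedSegment (k + 1) Y.1 t := congrArg Subtype.val h
  rcases le_total (s : ℝ) t with hst | hst
  · exact key X Y s t hst h
  · exact (key Y X t s hst h.symm).symm

theorem exists_polar_chart (Z : pointedSegments (k + 1)) :
    ∃ j : Fin k, (Z.1 j.succ).re ≠ 0 ∨ (Z.1 j.succ).im ≠ 0 := by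
  obtain ⟨j, hj⟩ := exists_ne_zero_of_mem_pointedSegments Z.2
  refine ⟨j, ?_⟩
  by_contra! h
  exact hj (Complex.ext h.1 h.2)

theorem toSegments_surjective : Function.Surjective (toSegments (k := k)) := by
  intro Z
  obtain ⟨j, h | h⟩ := exists_polar_chart Z
  · have hs := polarB_mem_slab Z.2 h
    -- The first argument of `pointB` is an irrelevant default value; any class will do.
    exact ⟨pointB (mk (⟨_, hs.1⟩, ⟨0, le_rfl, Real.pi_pos.le⟩)) _ _,
      Subtype.ext ((coe_toSegments_pointB _ hs).trans (rotatedSegment_polarB Z.2 h))⟩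
  · have hs := polarA_mem_slab Z.2 h
    exact ⟨mk (⟨_, hs.1⟩, ⟨_, hs.2.1.le, hs.2.2.le⟩), Subtype.ext (rotatedSegment_polarA Z.2 h)⟩

/-- The map `[X, θ] ↦ (0, e^{iθ} X)` as a bijection. -/
def equivSegments (k : ℕ) : PuncturedTorus k ≃ pointedSegments (k + 1) :=
  Equiv.ofBijective toSegments ⟨toSegments_injective, toSegments_surjective⟩

theorem chartA_mem_maximalAtlas (p : PuncturedTorus k) :
    chartA p ∈ IsManifold.maximalAtlas 𝓘(ℝ, (Fin k → ℝ) × ℝ) ∞ (PuncturedTorus k) :=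
  IsManifold.subset_maximalAtlas (Or.inl ⟨p, rfl⟩)

theorem chartB_mem_maximalAtlas (p : PuncturedTorus k) :
    chartB p ∈ IsManifold.maximalAtlas 𝓘(ℝ, (Fin k → ℝ) × ℝ) ∞ (PuncturedTorus k) :=
  IsManifold.subset_maximalAtlas (Or.inr ⟨p, rfl⟩)

/-- Both kinds of chart turn the map into `rotatedSegment`: for `coordB` with `θ ≥ π/2`, the sign of
`X` and the shift by `π` cancel. -/
theorem contMDiff_coe_toSegments :
    ContMDiff 𝓘(ℝ, (Fin k → ℝ) × ℝ) 𝓘(ℝ, Fin (k + 1) → ℂ) ∞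
      (Subtype.val ∘ toSegments : PuncturedTorus k → Fin (k + 1) → ℂ) := by
  have hrot : ContMDiff 𝓘(ℝ, (Fin k → ℝ) × ℝ) 𝓘(ℝ, Fin (k + 1) → ℂ) ∞
      fun x : (Fin k → ℝ) × ℝ => rotatedSegment (k + 1) x.1 x.2 :=
    contDiff_rotatedSegment.contMDiff
  intro p
  have hp := mem_chart_source ((Fin k → ℝ) × ℝ) p
  obtain ⟨e, he, hpe, h⟩ : ∃ e ∈ IsManifold.maximalAtlas 𝓘(ℝ, (Fin k → ℝ) × ℝ) ∞
      (PuncturedTorus k), p ∈ e.source ∧ ∀ q ∈ e.source,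
        (toSegments q : Fin (k + 1) → ℂ) = rotatedSegment (k + 1) (e q).1 (e q).2 := by
    rcases chart_mem_atlas ((Fin k → ℝ) × ℝ) p with ⟨q, hq⟩ | ⟨q, hq⟩
    · exact ⟨chartA q, chartA_mem_maximalAtlas q, hq ▸ hp,
        fun x hx => (rotatedSegment_coordA hx).symm⟩
    · exact ⟨chartB q, chartB_mem_maximalAtlas q, hq ▸ hp,
        fun x _ => (rotatedSegment_coordB x).symm⟩
  refine ContMDiffAt.congr_of_eventuallyEq (hrot.contMDiffAt.comp p
    (contMDiffAt_of_mem_maximalAtlas he hpe)) ?_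
  filter_upwards [e.open_source.mem_nhds hpe] with q hq using h q hq

/-- If a smooth map `g` of the ambient space inverts `toSegments` in the coordinates of a chart `e`
of the torus, then the inverse of `toSegments` is smooth. -/
theorem contMDiffAt_equivSegments_symm
    [ChartedSpace (EuclideanSpace ℝ (Fin (k + 1))) (pointedSegments (k + 1))]
    (hval : ContMDiff (𝓡 (k + 1)) 𝓘(ℝ, Fin (k + 1) → ℂ) ∞
      (Subtype.val : pointedSegments (k + 1) → Fin (k + 1) → ℂ))
    {e : OpenPartialHomeomorph (PuncturedTorus k) ((Fin k → ℝ) × ℝ)}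
    (he : e ∈ IsManifold.maximalAtlas 𝓘(ℝ, (Fin k → ℝ) × ℝ) ∞ (PuncturedTorus k))
    {g : (Fin (k + 1) → ℂ) → (Fin k → ℝ) × ℝ} {Z : pointedSegments (k + 1)}
    (hg : ContDiffAt ℝ ∞ g Z)
    (h : ∀ᶠ W : pointedSegments (k + 1) in nhds Z,
      g W ∈ e.target ∧ toSegments (e.symm (g W)) = W) :
    ContMDiffAt (𝓡 (k + 1)) 𝓘(ℝ, (Fin k → ℝ) × ℝ) ∞ (equivSegments k).symm Z := by
  have h1 : ContMDiffAt (𝓡 (k + 1)) 𝓘(ℝ, (Fin k → ℝ) × ℝ) ∞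
      (g ∘ (Subtype.val : pointedSegments (k + 1) → Fin (k + 1) → ℂ)) Z :=
    hg.contMDiffAt.comp Z hval.contMDiffAt
  refine ContMDiffAt.congr_of_eventuallyEq
    ((contMDiffAt_symm_of_mem_maximalAtlas he h.self_of_nhds.1).comp Z h1) ?_
  filter_upwards [h] with W hW
  exact (equivSegments k).symm_apply_eq.2 hW.2.symm

/-- Near `Z`, some entry has nonzero real or imaginary part; accordingly `polarB` or `polarA` is a
smooth ambient formula for the inverse in chart B or A. -/
theorem contMDiff_equivSegments_symm
    [ChartedSpace (EuclideanSpace ℝ (Fin (k + 1))) (pointedSegments (k + 1))]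
    (hval : ContMDiff (𝓡 (k + 1)) 𝓘(ℝ, Fin (k + 1) → ℂ) ∞
      (Subtype.val : pointedSegments (k + 1) → Fin (k + 1) → ℂ)) :
    ContMDiff (𝓡 (k + 1)) 𝓘(ℝ, (Fin k → ℝ) × ℝ) ∞ (equivSegments k).symm := by
  intro Z
  let p := (equivSegments k).symm Z
  obtain ⟨j, h | h⟩ := exists_polar_chart Z
  · refine contMDiffAt_equivSegments_symm hval (chartB_mem_maximalAtlas p)
      (contDiffAt_polarB h) ?_
    have ho : IsOpen {W : pointedSegments (k + 1) | (W.1 j.succ).re ≠ 0} :=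
      isOpen_ne_fun ((contDiff_re_apply (m := 0) j.succ).continuous.comp continuous_subtype_val)
        continuous_const
    filter_upwards [ho.mem_nhds h] with W hW
    have hs := polarB_mem_slab W.2 hW
    exact ⟨hs, Subtype.ext ((coe_toSegments_pointB p hs).trans (rotatedSegment_polarB W.2 hW))⟩
  · refine contMDiffAt_equivSegments_symm hval (chartA_mem_maximalAtlas p)
      (contDiffAt_polarA h) ?_
    have ho : IsOpen {W : pointedSegments (k + 1) | (W.1 j.succ).im ≠ 0} :=
      isOpen_ne_fun ((contDiff_im_apply (m := 0) j.succ).continuous.comp continuous_subtype_val)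
        continuous_const
    filter_upwards [ho.mem_nhds h] with W hW
    have hs := polarA_mem_slab W.2 hW
    exact ⟨hs, Subtype.ext ((coe_toSegments_point p hs.1 hs.2.1.le hs.2.2.le).trans
      (rotatedSegment_polarA W.2 hW))⟩

end PuncturedTorus

end

theorem theorem2p1 (n : ℕ) (hn : 3 ≤ n) :
    ∃ _ : ChartedSpace (EuclideanSpace ℝ (Fin n)) (pointedSegments n),
      IsManifold (𝓡 n) ∞ (pointedSegments n) ∧
      Manifold.IsSmoothEmbedding (𝓡 n) 𝓘(ℝ, Fin n → ℂ) ∞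
        (Subtype.val : pointedSegments n → (Fin n → ℂ)) ∧
      ∃ Ψ : PuncturedTorus (n - 1) ≃ₘ^∞⟮𝓘(ℝ, (Fin (n - 1) → ℝ) × ℝ), 𝓡 n⟯ pointedSegments n,
        ∀ (X : PuncturedSpace (n - 1)) (θ : Set.Icc (0 : ℝ) Real.pi),
          (Ψ (PuncturedTorus.mk (X, θ)) : Fin n → ℂ) = rotatedSegment n X θ := by
  -- After this substitution `n - 1` is `k` by definition, so the results stated for `k` apply
  -- directly.
  obtain ⟨k, rfl⟩ : ∃ k, n = k + 1 := ⟨n - 1, by omega⟩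
  let _ := (pointedSegmentsAtlas k).chartedSpace
  have hM : IsManifold (𝓡 (k + 1)) ∞ (pointedSegments (k + 1)) :=
    (pointedSegmentsAtlas k).isManifold
  have hE : Manifold.IsSmoothEmbedding (𝓡 (k + 1)) 𝓘(ℝ, Fin (k + 1) → ℂ) ∞
      (Subtype.val : pointedSegments (k + 1) → Fin (k + 1) → ℂ) :=
    (pointedSegmentsAtlas k).isSmoothEmbedding
  exact ⟨inferInstance, hM, hE,
    { toEquiv := PuncturedTorus.equivSegments k
      -- A continuous map into the source of an immersion is smooth once its composite with the
      -- immersion is.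
      contMDiff_toFun := (ContMDiff.iff_comp_isImmersion hE.isImmersion).2
        ⟨PuncturedTorus.continuous_toSegments, PuncturedTorus.contMDiff_coe_toSegments⟩
      contMDiff_invFun := PuncturedTorus.contMDiff_equivSegments_symm hE.contMDiff },
    fun X θ => rfl⟩
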